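/- **Setting.** A Co-MAPF instance consists of a finite undirected graph $G=(V,E)$, $k$ tasks, an initiator $\alpha_i$ and an executor $\beta_i$ for each task $i$, pairwise distinct start locations $\mathrm{start}(a)\in V$ of the $2k$ agents, and a task start $s_i$ and a task goal $g_i$ in $V$ for each task. Time is discrete; in each step an agent waits or moves along an edge, and the cost $|p|$ of a path $p$ is its number of time steps. A solution consists of a meeting $m_i=(v_i,t_i)\in V\times\mathbb N$ for each task and a path for each agent, such that the path of $\alpha_i$ starts in $\mathrm{start}(\alpha_i)$, is at $s_i$ at some time $\le t_i$, and ends in $v_i$ at time $t_i$, and the path of $\beta_i$ starts in $\mathrm{start}(\beta_i)$, is at $v_i$ at time $t_i$, and ends (not earlier) in $g_i$. Agents disappear when their path ends. A solution is feasible if no two agents are at the same vertex at the same time (except $\alpha_i,\beta_i$ at their meeting) and no two agents traverse an edge in opposite directions in the same time step. Its sum of costs is $\sum_i(|p_{\alpha_i}|+|p_{\beta_i}|)$. The endpoints are all agents' start locations and all task starts and goals. Two vertices are connected if some path between them has no endpoint in its interior. The instance is well-formed if for every task $i$ there is a non-endpoint connected with $s_i$, with $g_i$ and with $\mathrm{start}(\beta_i)$,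 and $s_i$ is connected with $\mathrm{start}(\alpha_i)$. **Co-CBS.** Let $d$ be the graph distance, $e_i(v)=\max\{d(\mathrm{start}(\alpha_i),s_i)+d(s_i,v),\,d(\mathrm{start}(\beta_i),v)\}$, and let the cost of a meeting be $C_i(v,t)=2t+d(v,g_i)$ if $t\ge e_i(v)$ and $\infty$ otherwise. The meetings table of task $i$ initially stores the meeting $(v,e_i(v))$ for each $v$; getting the next meeting returns a stored meeting $(v,t)$ of lowest cost and replaces it in the table by $(v,t+1)$. A search node consists of a set of constraints (agent $a$ must not be at $v$ at time $t$, or must not move from $u$ to $v$ between times $t$ and $t+1$), one meeting per task, and a solution, made of a minimum-cost path for each agent that plays the agent's part with these meetings and complies with the constraints on that agent; its cost is the sum of costs. Co-CBS starts with one root node, without constraints, whose meetings are the first ones from the tables. It repeatedly removes an open node $N$ of lowest cost (regular nodes before root nodes in case of a tie). If the solution of $N$ has no conflict, it is returned. Otherwise, if $N$ is a root, then for each task $i$ a new root node is opened, in which the meeting of task $i$ is replaced by the next one after it from the table of task $i$ and the paths of $\alpha_i,\beta_i$ are replanned (each root thus has its own state of the tables, inherited from its parent). Then, for either agent in a conflict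 of $N$, a regular node is opened that has the constraint by which this agent avoids the conflict in addition to those of $N$, and that agent's path is replanned; the node is discarded if no such path exists. **Theorem.** Let a well-formed Co-MAPF instance be given in which no agent's start location is the start or the goal of another pair's task, or, more generally, any well-formed instance that has a feasible solution. Then Co-CBS terminates and returns a feasible solution whose sum of costs is minimum among all feasible solutions, over all choices of meetings (locations and times) and of conflict-free paths. This holds for every way of breaking ties between meetings, nodes and paths and of choosing the conflict to split on. -/

import Mathlib

/-! Cooperative multi-agent path finding and the search algorithm Co-CBS. -/

namespace CoMAPF

/-- The `2 * k` agents: `Sum.inl i` is the initiator and `Sum.inr i` the executor of task `i`. -/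
abbrev Agent (k : ℕ) : Type := Fin k ⊕ Fin k

/-- The task an agent is assigned to. -/
def Agent.task {k : ℕ} : Agent k → Fin k
  | Sum.inl i => i
  | Sum.inr i => i

/-- A meeting is a location together with a time step. -/
structure Meeting (V : Type*) where
  loc : V
  time : ℕ

/-- A timed path: `pos t` is the location at time step `t`, for `t ≤ len`. The agent disappears
after time `len`, and no notion below looks at `pos t` for `t > len`. The cost of the path, its
number of time steps (waiting included), is `len`. -/
structure Path (V : Type*) where
  len : ℕ
  pos : ℕ → V

/-- A Co-MAPF instance with `k` tasks on a graph with vertex set `V`. Distinct agents have distinct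
start locations; task `i` consists of a start and a goal location. -/
structure Instance (V : Type*) (k : ℕ) where
  graph : SimpleGraph V
  start : Agent k → V
  start_injective : Function.Injective start
  taskStart : Fin k → V
  taskGoal : Fin k → V

/-- CBS constraints: `vertex a v t` forbids agent `a` to be at `v` at time `t`;
`edge a u v t` forbids agent `a` to move from `u` to `v` between times `t` and `t + 1`. -/
inductive Constraint (V : Type*) (k : ℕ) where
  | vertex (a : Agent k) (v : V) (t : ℕ)
  | edge (a : Agent k) (u v : V) (t : ℕ)

/-- The path `p`, taken by agent `a`, complies with a constraint. -/
def Complies {V : Type*} {k : ℕ} (a : Agent k) (p : Path V) : Constraint V k → Prop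
  | Constraint.vertex b v t => b = a → t ≤ p.len → p.pos t ≠ v
  | Constraint.edge b u v t => b = a → t + 1 ≤ p.len → ¬ (p.pos t = u ∧ p.pos (t + 1) = v)

/-- The sum of costs of a collection of paths, one for each agent. -/
def sumOfCosts {V : Type*} {k : ℕ} (P : Agent k → Path V) : ℕ :=
  ∑ i : Fin k, ((P (Sum.inl i)).len + (P (Sum.inr i)).len)

/-- Agents `a` and `b` share a task whose meeting is at `v` at time `t`. -/
def AtMeeting {V : Type*} {k : ℕ} (M : Fin k → Meeting V) (a b : Agent k) (v : V) (t : ℕ) : Prop :=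
  ∃ i, ((a = Sum.inl i ∧ b = Sum.inr i) ∨ (a = Sum.inr i ∧ b = Sum.inl i)) ∧
    (M i).loc = v ∧ (M i).time = t

/-- Two distinct agents are at `v` at time `t`, and this is not the meeting of a common task. -/
def VertexConflict {V : Type*} {k : ℕ} (M : Fin k → Meeting V) (P : Agent k → Path V)
    (a b : Agent k) (v : V) (t : ℕ) : Prop :=
  a ≠ b ∧ (t ≤ (P a).len ∧ (P a).pos t = v) ∧ (t ≤ (P b).len ∧ (P b).pos t = v) ∧
    ¬ AtMeeting M a b v t

/-- Between times `t` and `t + 1`, `a` moves from `u` to `v` while `b` moves from `v` to `u`. -/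
def EdgeConflict {V : Type*} {k : ℕ} (P : Agent k → Path V)
    (a b : Agent k) (u v : V) (t : ℕ) : Prop :=
  a ≠ b ∧ u ≠ v ∧
    (t + 1 ≤ (P a).len ∧ (P a).pos t = u ∧ (P a).pos (t + 1) = v) ∧
    (t + 1 ≤ (P b).len ∧ (P b).pos t = v ∧ (P b).pos (t + 1) = u)

/-- No two paths of `P` are in conflict, the meetings being `M`. -/
def ConflictFree {V : Type*} {k : ℕ} (M : Fin k → Meeting V) (P : Agent k → Path V) : Prop :=
  (∀ a b v t, ¬ VertexConflict M P a b v t) ∧ (∀ a b u v t, ¬ EdgeConflict P a b u v t)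

/-- A node of the search forest. `tables i v` is the time of the meeting of task `i` that the
meetings table of task `i` currently stores for location `v` (`⊤` if there is none). -/
structure Node (V : Type*) (k : ℕ) where
  isRoot : Bool
  constraints : Set (Constraint V k)
  meetings : Fin k → Meeting V
  tables : Fin k → V → ℕ∞
  solution : Agent k → Path V

/-- The cost of a node is the sum of costs of its solution. -/
def Node.cost {V : Type*} {k : ℕ} (N : Node V k) : ℕ := sumOfCosts N.solution

/-- The configurations of the main loop: still running with a given content of the open lists
(`Open` and `OpenRoots` together, told apart by `Node.isRoot`), or stopped with a solution. -/
inductive Config (V : Type*) (k : ℕ) where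
  | running (nodes : Multiset (Node V k))
  | returned (P : Agent k → Path V)

/-- `N` may be selected from the open nodes `N ::ₘ rest`: it has lowest cost, and a root node is
selected only if no regular node has the same cost. -/
def Selects {V : Type*} {k : ℕ} (N : Node V k) (rest : Multiset (Node V k)) : Prop :=
  (∀ N' ∈ rest, N.cost ≤ N'.cost) ∧
    (N.isRoot = true → ∀ N' ∈ rest, N'.cost = N.cost → N'.isRoot = true)

namespace Instance

variable {V : Type*} {k : ℕ} (I : Instance V k)

/-! ### Feasible and optimal solutions -/

/-- Consecutive positions are equal (wait) or adjacent (move). -/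
def IsPath (p : Path V) : Prop :=
  ∀ t < p.len, p.pos (t + 1) = p.pos t ∨ I.graph.Adj (p.pos t) (p.pos (t + 1))

/-- `p` is a path on which agent `a` plays its part in its task, with meetings `M`. The initiator
goes from its start through the task start to the meeting, where its path ends. The executor goes
from its start to the meeting and then to the task goal, where its path ends. -/
def Serves (M : Fin k → Meeting V) : Agent k → Path V → Prop
  | Sum.inl i, p => I.IsPath p ∧ p.pos 0 = I.start (Sum.inl i) ∧
      (∃ t ≤ (M i).time, p.pos t = I.taskStart i) ∧
      p.len = (M i).time ∧ p.pos (M i).time = (M i).loc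
  | Sum.inr i, p => I.IsPath p ∧ p.pos 0 = I.start (Sum.inr i) ∧
      (M i).time ≤ p.len ∧ p.pos (M i).time = (M i).loc ∧ p.pos p.len = I.taskGoal i

/-- A feasible solution: for some choice of meetings, every agent plays its part and there are no
conflicts. -/
def Feasible (P : Agent k → Path V) : Prop :=
  ∃ M : Fin k → Meeting V, (∀ a, I.Serves M a (P a)) ∧ ConflictFree M P

/-- A feasible solution of minimum sum of costs, over all choices of meetings and paths. -/
def Optimal (P : Agent k → Path V) : Prop :=
  I.Feasible P ∧ ∀ Q : Agent k → Path V, I.Feasible Q → sumOfCosts P ≤ sumOfCosts Q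

/-! ### Well-formed instances -/

/-- The endpoints: start locations of the agents, start and goal locations of the tasks. -/
def endpoints : Set V := Set.range I.start ∪ Set.range I.taskStart ∪ Set.range I.taskGoal

/-- There is a path from `u` to `v` all of whose vertices other than `u` and `v` are
non-endpoints. -/
def Connected (u v : V) : Prop :=
  ∃ p : I.graph.Walk u v, p.IsPath ∧ ∀ w ∈ p.support, w ≠ u → w ≠ v → w ∉ I.endpoints

/-- Well-formed instances. -/
structure WellFormed : Prop where
  exists_meeting : ∀ i, ∃ v, v ∉ I.endpoints ∧ I.Connected v (I.taskStart i) ∧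
    I.Connected v (I.taskGoal i) ∧ I.Connected v (I.start (Sum.inr i))
  connected_start : ∀ i, I.Connected (I.taskStart i) (I.start (Sum.inl i))

/-- An agent that rests at its start location does not occupy the start or the goal location of
a task of other agents. -/
def StartsFree : Prop :=
  ∀ (a : Agent k) (i : Fin k), a.task ≠ i → I.start a ≠ I.taskStart i ∧ I.start a ≠ I.taskGoal i

/-! ### Meetings tables -/

/-- The earliest time at which both agents of task `i` can be at `v`. -/
noncomputable def earliest (i : Fin k) (v : V) : ℕ∞ :=
  max (I.graph.edist (I.start (Sum.inl i)) (I.taskStart i) + I.graph.edist (I.taskStart i) v)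
    (I.graph.edist (I.start (Sum.inr i)) v)

open Classical in
/-- The cost of completing task `i` with a meeting at `v` at time `t`. -/
noncomputable def meetingCost (i : Fin k) (v : V) (t : ℕ∞) : ℕ∞ :=
  if I.earliest i v ≤ t then 2 * t + I.graph.edist v (I.taskGoal i) else ⊤

open Classical in
/-- Getting the next meeting from a table of task `i`: `m` is a lowest-cost meeting stored in the
table `T`, and in the updated table its location stores the meeting one time step later. -/
def NextMeeting (i : Fin k) (T : V → ℕ∞) (m : Meeting V) (T' : V → ℕ∞) : Prop :=
  T m.loc = (m.time : ℕ∞) ∧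
    (∀ v, I.meetingCost i m.loc m.time ≤ I.meetingCost i v (T v)) ∧
    T' = Function.update T m.loc ((m.time : ℕ∞) + 1)

/-! ### The algorithm

Whenever the algorithm leaves a choice open (the order of equal-cost meetings, of equal-cost nodes,
of equal-cost paths, the conflict found by the validation), all choices are allowed. -/

/-- The paths level: `p` is a possible outcome of planning a path for agent `a`, that is, a
lowest-cost path among those that serve the task and comply with the constraints `C`. -/
def Plans (M : Fin k → Meeting V) (C : Set (Constraint V k)) (a : Agent k) (p : Path V) : Prop :=
  (I.Serves M a p ∧ ∀ c ∈ C, Complies a p c) ∧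
    ∀ q : Path V, I.Serves M a q → (∀ c ∈ C, Complies a q c) → p.len ≤ q.len

/-- `R` is the first root node: the meetings are lowest-cost ones taken from the initial tables. -/
def FirstRoot (R : Node V k) : Prop :=
  R.isRoot = true ∧ R.constraints = ∅ ∧
    (∀ i, I.NextMeeting i (I.earliest i) (R.meetings i) (R.tables i)) ∧
    ∀ a, I.Plans R.meetings ∅ a (R.solution a)

open Classical in
/-- `R` is a root node generated from the root node `N` by replacing the meeting of task `i` by
the next one and replanning the two agents of that task. -/
def NextRoot (N : Node V k) (i : Fin k) (R : Node V k) : Prop :=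
  ∃ (m : Meeting V) (T : V → ℕ∞) (pA pB : Path V),
    I.NextMeeting i (N.tables i) m T ∧
    R = { isRoot := true
          constraints := ∅
          meetings := Function.update N.meetings i m
          tables := Function.update N.tables i T
          solution :=
            Function.update (Function.update N.solution (Sum.inl i) pA) (Sum.inr i) pB } ∧
    I.Plans R.meetings ∅ (Sum.inl i) pA ∧ I.Plans R.meetings ∅ (Sum.inr i) pB

open Classical in
/-- Adding the constraint `c` on agent `a` to the node `N` yields the (at most one) regular node in
`new`: agent `a` is replanned; if it has no path any more, the node has no solution (infinite cost)
and is discarded. -/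
def Child (N : Node V k) (a : Agent k) (c : Constraint V k) (new : Multiset (Node V k)) : Prop :=
  (∃ p, I.Plans N.meetings (insert c N.constraints) a p ∧
    new = {{ isRoot := false
             constraints := insert c N.constraints
             meetings := N.meetings
             tables := N.tables
             solution := Function.update N.solution a p }}) ∨
  ((¬ ∃ p, I.Plans N.meetings (insert c N.constraints) a p) ∧ new = 0)

/-- The nodes `new` result from splitting `N` on a conflict of its solution. -/
def Splits (N : Node V k) (new : Multiset (Node V k)) : Prop :=
  (∃ a b v t X Y, VertexConflict N.meetings N.solution a b v t ∧
    I.Child N a (Constraint.vertex a v t) X ∧ I.Child N b (Constraint.vertex b v t) Y ∧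
    new = X + Y) ∨
  (∃ a b u v t X Y, EdgeConflict N.solution a b u v t ∧
    I.Child N a (Constraint.edge a u v t) X ∧ I.Child N b (Constraint.edge b v u t) Y ∧
    new = X + Y)

/-- One iteration of the main loop of Co-CBS. -/
inductive Step : Config V k → Config V k → Prop
  | ret (N : Node V k) (rest : Multiset (Node V k)) :
      Selects N rest → ConflictFree N.meetings N.solution →
      Step (Config.running (N ::ₘ rest)) (Config.returned N.solution)
  | regular (N : Node V k) (rest new : Multiset (Node V k)) :
      Selects N rest → N.isRoot = false → I.Splits N new →
      Step (Config.running (N ::ₘ rest)) (Config.running (new + rest))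
  | root (N : Node V k) (rest new : Multiset (Node V k)) (R : Fin k → Node V k) :
      Selects N rest → N.isRoot = true → (∀ i, I.NextRoot N i (R i)) → I.Splits N new →
      Step (Config.running (N ::ₘ rest))
        (Config.running (new + Finset.univ.val.map R + rest))

/-- The main loop starts with the first root node as the only open node. -/
def Initial (c : Config V k) : Prop := ∃ R, I.FirstRoot R ∧ c = Config.running {R}

/-- Co-CBS can start, no run of it is infinite, and every run, continued until no iteration is
possible, has stopped with a solution that has the property `Good` (in particular it does not
exhaust the open lists). -/
def CoCBSReturns (Good : (Agent k → Path V) → Prop) : Prop :=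
  (∃ c, I.Initial c) ∧
  (¬ ∃ run : ℕ → Config V k, I.Initial (run 0) ∧ ∀ n, I.Step (run n) (run (n + 1))) ∧
  (∀ c c', I.Initial c → Relation.ReflTransGen I.Step c c' → (∀ d, ¬ I.Step c' d) →
    ∃ P, c' = Config.returned P ∧ Good P)

end Instance

end CoMAPF

/-! # Optimality and termination of Co-CBS

*Existence of a feasible solution.* If resting agents do not block other tasks, the tasks can be
served one after another (`WellFormed.exists_feasible`). The agents of a task meet at the task start
rather than at the non-endpoint that well-formedness provides; through the latter, the executor can
reach the task start, and then the task goal, without visiting other endpoints. Since the executor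
may be at the task start only at the moment of the meeting, this works even if the task starts where
its executor starts, in which case the initiator might be unable to get past an executor that has
moved out of the way.

*Optimality.* For every feasible solution `Q` with meetings `M`, some open node always leaves room
for it (`Covers`): either a node with the meetings `M` whose constraints `Q` satisfies, or a root
node from which the meetings `M` can still be reached by advancing the meetings tables. A split
preserves the former, because `Q` avoids the conflict by one of the two agents
(`Splits.exists_covers`). Expanding a root node preserves the latter, because some task does not
have its meeting in `M` yet and the tables deliver meetings in the order of their costs
(`NextMeeting.le_meetingCost`). Such a node costs no more than `Q`: each of its paths has minimum
cost under fewer restrictions, or its meetings, whose costs its paths attain, cost no more than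
those in `M`, and the cost of a
meeting bounds the joint cost of any two paths for it from below (`Covers.cost_le`). Hence the
selected node, and with it a returned solution, costs no more than any feasible solution. As
feasible solutions exist, the open lists are never exhausted.

*Termination.* For the same reason, only nodes of cost at most `B` are expanded, where `B` is the
cost of some feasible solution. Along a branch, each constraint is new and has a time step of at
most `B`, and each root node of cost at most `B` advances an entry of the meetings tables that is at
most `B`. So a `rank` decreases from every expanded node to its finitely many successors, and the
multiset of open nodes cannot be rewritten in this way forever (`WellFounded.cutExpand`). -/

namespace CoMAPF

namespace Instance

variable {V : Type*} {k : ℕ} {I : Instance V k}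

/-! ### Walks as timed paths -/

/-- Following a walk from time `τ` on, resting at its ends before and afterwards, is a timed path;
the truncated subtraction accounts for the rest before time `τ`. -/
theorem getVert_sub_succ {G : SimpleGraph V} {u w : V} (p : G.Walk u w) (τ t : ℕ) :
    p.getVert (t + 1 - τ) = p.getVert (t - τ) ∨
      G.Adj (p.getVert (t - τ)) (p.getVert (t + 1 - τ)) := by
  rcases lt_or_ge t τ with h | h
  · left
    rw [Nat.sub_eq_zero_of_le h.le, Nat.sub_eq_zero_of_le h]
  · rw [Nat.sub_add_comm h]
    rcases lt_or_ge (t - τ) p.length with h' | h'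
    · exact Or.inr (p.adj_getVert_succ h')
    · left
      rw [p.getVert_of_length_le h', p.getVert_of_length_le (by omega)]

theorem getVert_succ {G : SimpleGraph V} {u w : V} (p : G.Walk u w) (t : ℕ) :
    p.getVert (t + 1) = p.getVert t ∨ G.Adj (p.getVert t) (p.getVert (t + 1)) :=
  getVert_sub_succ p 0 t

theorem getVert_append_length {G : SimpleGraph V} {u v w : V} (p : G.Walk u v) (q : G.Walk v w)
    (t : ℕ) : (p.append q).getVert (p.length + t) = q.getVert t := by
  rw [SimpleGraph.Walk.getVert_append, if_neg (by omega), Nat.add_sub_cancel_left]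

theorem getVert_append_of_le {G : SimpleGraph V} {u v w : V} (p : G.Walk u v) (q : G.Walk v w)
    {t : ℕ} (ht : t ≤ p.length) : (p.append q).getVert t = p.getVert t := by
  rcases ht.lt_or_eq with h | rfl
  · rw [SimpleGraph.Walk.getVert_append, if_pos h]
  · simpa using getVert_append_length p q 0

theorem eq_length_of_getVert_eq {G : SimpleGraph V} {u w : V} {p : G.Walk u w} (hp : p.IsPath)
    {n : ℕ} (hn : n ≤ p.length) (h : p.getVert n = w) : n = p.length :=
  hp.getVert_injOn hn (show p.length ≤ p.length from le_rfl) (h.trans p.getVert_length.symm)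

/-- A timed path needs at least the graph distance between any two of its locations. -/
theorem IsPath.edist_le {p : Path V} (hp : I.IsPath p) {s t : ℕ} (hst : s ≤ t) (ht : t ≤ p.len) :
    I.graph.edist (p.pos s) (p.pos t) ≤ ((t - s : ℕ) : ℕ∞) := by
  induction t, hst using Nat.le_induction with
  | base => simp
  | succ t hst ih =>
    have hstep : I.graph.edist (p.pos t) (p.pos (t + 1)) ≤ 1 := by
      rcases hp t ht with h | h
      · simp [h]
      · exact (SimpleGraph.edist_eq_one_iff_adj.2 h).le
    calc I.graph.edist (p.pos s) (p.pos (t + 1))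
        ≤ I.graph.edist (p.pos s) (p.pos t) + I.graph.edist (p.pos t) (p.pos (t + 1)) :=
          SimpleGraph.edist_triangle
      _ ≤ ((t - s : ℕ) : ℕ∞) + 1 := add_le_add (ih (by omega)) hstep
      _ = ((t + 1 - s : ℕ) : ℕ∞) := by
          rw [Nat.sub_add_comm hst, Nat.cast_add, Nat.cast_one]

/-! ### Connections avoiding endpoints -/

theorem Connected.symm {u v : V} (h : I.Connected u v) : I.Connected v u := by
  obtain ⟨p, hp, hs⟩ := h
  refine ⟨p.reverse, hp.reverse, fun w hw hv hu => hs w ?_ hu hv⟩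
  simpa using hw

/-- Connections can be concatenated at a non-endpoint. -/
theorem Connected.trans {u v w : V} (hv : v ∉ I.endpoints) (h₁ : I.Connected u v)
    (h₂ : I.Connected v w) : I.Connected u w := by
  classical
  obtain ⟨p, -, hp⟩ := h₁
  obtain ⟨q, -, hq⟩ := h₂
  refine ⟨(p.append q).bypass, SimpleGraph.Walk.bypass_isPath _, fun x hx hu hw => ?_⟩
  by_cases hxv : x = v
  · exact hxv ▸ hv
  rcases (SimpleGraph.Walk.mem_support_append_iff _ _).1
    (SimpleGraph.Walk.support_bypass_subset_support _ hx) with h | h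
  · exact hp x h hu hxv
  · exact hq x h hxv hw

theorem Connected.edist_ne_top {u v : V} (h : I.Connected u v) : I.graph.edist u v ≠ ⊤ := by
  obtain ⟨p, -, -⟩ := h
  exact ne_top_of_le_ne_top (ENat.natCast_ne_top _) p.edist_le

theorem WellFormed.connected_meeting (hwf : I.WellFormed) (i : Fin k) :
    I.Connected (I.start (Sum.inr i)) (I.taskStart i) := by
  obtain ⟨v, hv, h₁, -, h₃⟩ := hwf.exists_meeting i
  exact h₃.symm.trans hv h₁

theorem WellFormed.connected_goal (hwf : I.WellFormed) (i : Fin k) :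
    I.Connected (I.taskStart i) (I.taskGoal i) := by
  obtain ⟨v, hv, h₁, h₂, -⟩ := hwf.exists_meeting i
  exact h₁.symm.trans hv h₂

/-! ### A feasible solution that serves the tasks one after another -/

/-- A collection of paths in which the tasks are served in disjoint time intervals, task `i` from
time `τ i` on, so that agents of later tasks still rest at their start locations, and in which no
start location of an agent of a later task is visited, has no conflict between different tasks. -/
theorem no_conflict_of_task_lt {P : Agent k → Path V} {τ : Fin k → ℕ}
    (hrest : ∀ a, ∀ t ≤ τ a.task, (P a).pos t = I.start a)
    (hlen : ∀ a b : Agent k, a.task < b.task → (P a).len ≤ τ b.task)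
    (havoid : ∀ a b t, a.task < b.task → (P a).pos t ≠ I.start b)
    {a b : Agent k} (hab : a.task < b.task) {t : ℕ} :
    (t ≤ (P a).len → (P a).pos t ≠ (P b).pos t) ∧
      (t + 1 ≤ (P a).len → (P b).pos t = (P b).pos (t + 1)) := by
  have := hlen a b hab
  refine ⟨fun ht => ?_, fun ht => ?_⟩
  · rw [hrest b t (by omega)]
    exact havoid a b t hab
  · rw [hrest b t (by omega), hrest b (t + 1) (by omega)]

/-- If the agents resting at their start locations do not block other tasks, a well-formed instance
has a feasible solution. The tasks are served one after another, and the agents of task `i` meet at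
the task start: the initiator goes there while the executor rests at its start, then the executor
comes, and goes on to the task goal after the initiator has disappeared. This also covers a task
that starts where its own executor starts, since both agents may be there at their meeting. -/
theorem WellFormed.exists_feasible (hwf : I.WellFormed) (hfree : I.StartsFree) :
    ∃ Q, I.Feasible Q := by
  choose pA hA hA' using fun i => (hwf.connected_start i).symm
  choose pB hB hB' using hwf.connected_meeting
  choose pG hG hG' using hwf.connected_goal
  set D : ℕ := ∑ i, ((pA i).length + (pB i).length + (pG i).length) with hD
  have hDle : ∀ i, (pA i).length + (pB i).length + (pG i).length ≤ D := fun i =>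
    Finset.single_le_sum
      (f := fun i => (pA i).length + (pB i).length + (pG i).length)
      (fun _ _ => Nat.zero_le _) (Finset.mem_univ i)
  set τ : Fin k → ℕ := fun i => i * D with hτ
  have hτlt : ∀ i j : Fin k, i < j → τ i + D ≤ τ j := fun i j hij => by
    have h : (i : ℕ) + 1 ≤ j := hij
    calc τ i + D = ((i : ℕ) + 1) * D := by simp only [hτ]; ring
      _ ≤ τ j := Nat.mul_le_mul_right D h
  let Q : Agent k → Path V := fun a => match a with
    | Sum.inl i => ⟨τ i + (pA i).length + (pB i).length, fun t => (pA i).getVert (t - τ i)⟩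
    | Sum.inr i => ⟨τ i + (pA i).length + (pB i).length + (pG i).length,
        fun t => ((pB i).append (pG i)).getVert (t - (τ i + (pA i).length))⟩
  let M : Fin k → Meeting V := fun i =>
    ⟨I.taskStart i, τ i + (pA i).length + (pB i).length⟩
  have hrest : ∀ a, ∀ t ≤ τ a.task, (Q a).pos t = I.start a := by
    rintro (i | i) t ht
    · change (pA i).getVert (t - τ i) = _
      rw [Nat.sub_eq_zero_of_le (show t ≤ τ i from ht)]
      simp
    · change ((pB i).append (pG i)).getVert (t - (τ i + (pA i).length)) = _
      rw [Nat.sub_eq_zero_of_le (le_add_right (show t ≤ τ i from ht))]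
      simp
  have hlen : ∀ a b : Agent k, a.task < b.task → (Q a).len ≤ τ b.task := by
    rintro (i | i) b hab
    · have h : τ i + D ≤ τ b.task := hτlt _ _ hab
      have := hDle i
      change τ i + (pA i).length + (pB i).length ≤ _
      omega
    · have h : τ i + D ≤ τ b.task := hτlt _ _ hab
      have := hDle i
      change τ i + (pA i).length + (pB i).length + (pG i).length ≤ _
      omega
  have hvisit : ∀ a t, (Q a).pos t ∈ I.endpoints → (Q a).pos t = I.start (Sum.inl a.task) ∨
      (Q a).pos t = I.start (Sum.inr a.task) ∨ (Q a).pos t = I.taskStart a.task ∨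
      (Q a).pos t = I.taskGoal a.task := by
    rintro (i | i) t
    · change (pA i).getVert (t - τ i) ∈ _ → (pA i).getVert (t - τ i) = I.start (Sum.inl i) ∨
        (pA i).getVert (t - τ i) = I.start (Sum.inr i) ∨
        (pA i).getVert (t - τ i) = I.taskStart i ∨ (pA i).getVert (t - τ i) = I.taskGoal i
      have h := hA' i _ ((pA i).getVert_mem_support (t - τ i))
      tauto
    · change ((pB i).append (pG i)).getVert (t - (τ i + (pA i).length)) ∈ _ →
        ((pB i).append (pG i)).getVert (t - (τ i + (pA i).length)) = I.start (Sum.inl i) ∨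
        ((pB i).append (pG i)).getVert (t - (τ i + (pA i).length)) = I.start (Sum.inr i) ∨
        ((pB i).append (pG i)).getVert (t - (τ i + (pA i).length)) = I.taskStart i ∨
        ((pB i).append (pG i)).getVert (t - (τ i + (pA i).length)) = I.taskGoal i
      rcases (SimpleGraph.Walk.mem_support_append_iff _ _).1
        (((pB i).append (pG i)).getVert_mem_support (t - (τ i + (pA i).length))) with h | h
      · have := hB' i _ h
        tauto
      · have := hG' i _ h
        tauto
  have havoid : ∀ a b t, a.task < b.task → (Q a).pos t ≠ I.start b := by
    intro a b t hab h
    have hf := hfree b a.task hab.ne'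
    have hne : ∀ c : Agent k, c.task = a.task → (Q a).pos t ≠ I.start c := by
      rintro c hc hc'
      have := I.start_injective (h.symm.trans hc')
      rw [this, hc] at hab
      exact hab.false
    rcases hvisit a t (h ▸ Or.inl (Or.inl ⟨b, rfl⟩)) with h' | h' | h' | h'
    · exact hne (Sum.inl a.task) rfl h'
    · exact hne (Sum.inr a.task) rfl h'
    · exact hf.1 (h.symm.trans h')
    · exact hf.2 (h.symm.trans h')
  -- The two agents of a task are at the same location only at their meeting.
  have hmeet : ∀ i t, t ≤ τ i + (pA i).length + (pB i).length →
      (Q (Sum.inl i)).pos t = (Q (Sum.inr i)).pos t →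
      t = τ i + (pA i).length + (pB i).length ∧ (Q (Sum.inl i)).pos t = I.taskStart i := by
    intro i t ht h
    change (pA i).getVert (t - τ i) =
      ((pB i).append (pG i)).getVert (t - (τ i + (pA i).length)) at h
    change _ ∧ (pA i).getVert (t - τ i) = _
    rcases le_or_gt t (τ i + (pA i).length) with h' | h'
    · -- The executor still rests, which the initiator only meets at its destination.
      rw [Nat.sub_eq_zero_of_le h', SimpleGraph.Walk.getVert_zero] at h
      have hS : I.start (Sum.inr i) = I.taskStart i := by
        by_contra hne
        refine hA' i _ (h ▸ (pA i).getVert_mem_support (t - τ i)) (fun h => ?_) hne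
          (Or.inl (Or.inl ⟨_, rfl⟩))
        exact Sum.inr_ne_inl (I.start_injective h)
      have hb : 0 = (pB i).length := eq_length_of_getVert_eq (hB i) (Nat.zero_le _)
        (by simpa using hS)
      have ha : t - τ i = (pA i).length := eq_length_of_getVert_eq (hA i) (by omega) (h.trans hS)
      have ha0 : (pA i).length ≠ 0 := fun h0 => by
        have := SimpleGraph.Walk.eq_of_length_eq_zero h0
        exact Sum.inr_ne_inl (I.start_injective (hS.trans this.symm))
      exact ⟨by omega, h.trans hS⟩
    · have hn : t - (τ i + (pA i).length) ≤ (pB i).length := by omega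
      have hl : (pA i).getVert (t - τ i) = I.taskStart i :=
        (pA i).getVert_of_length_le (by omega)
      rw [hl, getVert_append_of_le _ _ hn] at h
      have hb : t - (τ i + (pA i).length) = (pB i).length := eq_length_of_getVert_eq (hB i) hn h.symm
      exact ⟨by omega, hl⟩
  -- The two agents of a task do not move in the same time step until they meet.
  have hwait : ∀ i t, t + 1 ≤ τ i + (pA i).length + (pB i).length →
      (Q (Sum.inl i)).pos t = (Q (Sum.inl i)).pos (t + 1) ∨
      (Q (Sum.inr i)).pos t = (Q (Sum.inr i)).pos (t + 1) := by
    intro i t ht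
    rcases le_or_gt (τ i + (pA i).length) t with h' | h'
    · left
      change (pA i).getVert (t - τ i) = (pA i).getVert (t + 1 - τ i)
      rw [SimpleGraph.Walk.getVert_of_length_le _ (by omega),
        SimpleGraph.Walk.getVert_of_length_le _ (by omega)]
    · right
      change ((pB i).append (pG i)).getVert (t - (τ i + (pA i).length)) =
        ((pB i).append (pG i)).getVert (t + 1 - (τ i + (pA i).length))
      rw [Nat.sub_eq_zero_of_le h'.le, Nat.sub_eq_zero_of_le h']
  refine ⟨Q, M, ?_, ?_, ?_⟩
  · rintro (i | i)
    · refine ⟨fun t _ => getVert_sub_succ (pA i) _ t, hrest (Sum.inl i) 0 (Nat.zero_le _),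
        ⟨τ i + (pA i).length, Nat.le_add_right _ _, ?_⟩, rfl, ?_⟩
      · exact (pA i).getVert_of_length_le (by omega)
      · exact (pA i).getVert_of_length_le
          (show (pA i).length ≤ τ i + (pA i).length + (pB i).length - τ i by omega)
    · refine ⟨fun t _ => getVert_sub_succ _ _ t, hrest (Sum.inr i) 0 (Nat.zero_le _),
        Nat.le_add_right _ _, ?_, ?_⟩
      · change ((pB i).append (pG i)).getVert
          (τ i + (pA i).length + (pB i).length - (τ i + (pA i).length)) = _
        rw [Nat.add_sub_cancel_left, getVert_append_of_le _ _ le_rfl]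
        exact (pB i).getVert_length
      · refine SimpleGraph.Walk.getVert_of_length_le _ ?_
        change _ ≤ τ i + (pA i).length + (pB i).length + (pG i).length -
          (τ i + (pA i).length)
        rw [SimpleGraph.Walk.length_append]
        omega
  · rintro a b v t ⟨hne, ⟨hta, hpa⟩, ⟨htb, hpb⟩, hm⟩
    rcases lt_trichotomy a.task b.task with hab | hab | hab
    · exact (no_conflict_of_task_lt hrest hlen havoid hab).1 hta (hpa.trans hpb.symm)
    · rcases a with i | i <;> rcases b with j | j <;> obtain rfl : i = j := hab
      · exact hne rfl
      · obtain ⟨h₁, h₂⟩ := hmeet i t hta (hpa.trans hpb.symm)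
        exact hm ⟨i, Or.inl ⟨rfl, rfl⟩, h₂.symm.trans hpa, h₁.symm⟩
      · obtain ⟨h₁, h₂⟩ := hmeet i t htb (hpb.trans hpa.symm)
        exact hm ⟨i, Or.inr ⟨rfl, rfl⟩, h₂.symm.trans hpb, h₁.symm⟩
      · exact hne rfl
    · exact (no_conflict_of_task_lt hrest hlen havoid hab).1 htb (hpb.trans hpa.symm)
  · rintro a b u v t ⟨hne, huv, ⟨hta, hpa, hpa'⟩, ⟨htb, hpb, hpb'⟩⟩
    rcases lt_trichotomy a.task b.task with hab | hab | hab
    · have := (no_conflict_of_task_lt hrest hlen havoid hab).2 hta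
      exact huv (hpb'.symm.trans (this.symm.trans hpb))
    · rcases a with i | i <;> rcases b with j | j <;> obtain rfl : i = j := hab
      · exact hne rfl
      · rcases hwait i t hta with h | h
        · exact huv (hpa.symm.trans (h.trans hpa'))
        · exact huv (hpb'.symm.trans (h.symm.trans hpb))
      · rcases hwait i t htb with h | h
        · exact huv (hpb'.symm.trans (h.symm.trans hpb))
        · exact huv (hpa.symm.trans (h.trans hpa'))
      · exact hne rfl
    · have := (no_conflict_of_task_lt hrest hlen havoid hab).2 htb
      exact huv (hpa.symm.trans (this.trans hpa'))

/-! ### Meeting costs and planned paths -/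

theorem of_meetingCost_ne_top {i : Fin k} {v : V} {t : ℕ∞} (h : I.meetingCost i v t ≠ ⊤) :
    I.earliest i v ≤ t ∧ t ≠ ⊤ ∧ I.graph.edist v (I.taskGoal i) ≠ ⊤ := by
  unfold meetingCost at h
  split_ifs at h with he
  · refine ⟨he, ?_, ?_⟩
    · rintro rfl
      simp at h
    · intro hd
      simp [hd] at h
  · exact absurd rfl h

theorem meetingCost_mono {i : Fin k} {v : V} {t t' : ℕ∞} (ht : I.earliest i v ≤ t)
    (htt' : t ≤ t') : I.meetingCost i v t ≤ I.meetingCost i v t' := by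
  simp only [meetingCost, if_pos ht, if_pos (ht.trans htt')]
  gcongr

/-- The cost of a meeting is a lower bound on the joint cost of the paths of its two agents. -/
theorem meetingCost_le_of_serves {M : Fin k → Meeting V} {P : Agent k → Path V}
    (hP : ∀ a, I.Serves M a (P a)) (i : Fin k) :
    I.meetingCost i (M i).loc (M i).time ≤
      (((P (Sum.inl i)).len + (P (Sum.inr i)).len : ℕ) : ℕ∞) := by
  obtain ⟨hA, hA0, ⟨s, hs, hAs⟩, hAlen, hAt⟩ := hP (Sum.inl i)
  obtain ⟨hB, hB0, hBt, hBm, hBg⟩ := hP (Sum.inr i)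
  have h₁ := hA.edist_le (Nat.zero_le s) (hs.trans hAlen.ge)
  have h₂ := hA.edist_le hs hAlen.ge
  have h₃ := hB.edist_le (Nat.zero_le _) hBt
  have h₄ := hB.edist_le hBt le_rfl
  rw [hA0, hAs] at h₁
  rw [hAs, hAt] at h₂
  rw [hB0, hBm] at h₃
  rw [hBm, hBg] at h₄
  have he : I.earliest i (M i).loc ≤ (M i).time := by
    refine max_le ((add_le_add h₁ h₂).trans ?_) (h₃.trans ?_)
    · norm_cast
      omega
    · norm_cast
  rw [meetingCost, if_pos he]
  calc 2 * ((M i).time : ℕ∞) + I.graph.edist (M i).loc (I.taskGoal i)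
      ≤ 2 * ((M i).time : ℕ∞) + (((P (Sum.inr i)).len - (M i).time : ℕ) : ℕ∞) := by gcongr
    _ = _ := by
      norm_cast
      omega

theorem exists_serves_initiator {M : Fin k → Meeting V} {i : Fin k}
    (h : I.earliest i (M i).loc ≤ (M i).time) : ∃ p, I.Serves M (Sum.inl i) p := by
  have hle := (le_max_left _ _).trans h
  have hne := ne_top_of_le_ne_top (ENat.natCast_ne_top _) hle
  obtain ⟨p, hp⟩ := SimpleGraph.exists_walk_of_edist_ne_top
    (ne_top_of_le_ne_top hne le_self_add)
  obtain ⟨q, hq⟩ := SimpleGraph.exists_walk_of_edist_ne_top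
    (ne_top_of_le_ne_top hne le_add_self)
  rw [← hp, ← hq] at hle
  have hle : p.length + q.length ≤ (M i).time := by exact_mod_cast hle
  refine ⟨⟨(M i).time, (p.append q).getVert⟩, fun t _ => getVert_succ _ t, by simp,
    ⟨p.length, by omega, ?_⟩, rfl, ?_⟩
  · exact (getVert_append_of_le p q le_rfl).trans p.getVert_length
  · exact SimpleGraph.Walk.getVert_of_length_le _ (by simpa using hle)

theorem exists_serves_executor {M : Fin k → Meeting V} {i : Fin k}
    (h : I.earliest i (M i).loc ≤ (M i).time)
    (hg : I.graph.edist (M i).loc (I.taskGoal i) ≠ ⊤) :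
    ∃ p, I.Serves M (Sum.inr i) p ∧
      (p.len : ℕ∞) = (M i).time + I.graph.edist (M i).loc (I.taskGoal i) := by
  have hle := (le_max_right _ _).trans h
  obtain ⟨p, hp⟩ := SimpleGraph.exists_walk_of_edist_ne_top
    (ne_top_of_le_ne_top (ENat.natCast_ne_top _) hle)
  obtain ⟨q, hq⟩ := SimpleGraph.exists_walk_of_edist_ne_top hg
  rw [← hp] at hle
  have hle : p.length ≤ (M i).time := by exact_mod_cast hle
  have hpt : p.getVert (M i).time = (M i).loc := p.getVert_of_length_le hle
  refine ⟨⟨(M i).time + q.length,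
    fun t => if t ≤ (M i).time then p.getVert t else q.getVert (t - (M i).time)⟩,
    ⟨fun t _ => ?_, by simp, by simp, by simpa using hpt, ?_⟩, ?_⟩
  · rcases lt_trichotomy t (M i).time with ht | rfl | ht
    · simpa [ht.le, Nat.succ_le_of_lt ht] using getVert_succ p t
    · simpa [hpt] using getVert_succ q 0
    · simpa [ht.not_ge, (Nat.lt_succ_of_lt ht).not_ge] using getVert_sub_succ q (M i).time t
  · change (if (M i).time + q.length ≤ (M i).time then _ else _) = _
    split_ifs with hq0
    · change p.getVert ((M i).time + q.length) = _
      have h0 : q.length = 0 := by omega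
      rw [h0, Nat.add_zero, hpt]
      exact SimpleGraph.Walk.eq_of_length_eq_zero h0
    · simp
  · simp [hq]

theorem exists_plans {M : Fin k → Meeting V} {C : Set (Constraint V k)} {a : Agent k}
    (h : ∃ p, I.Serves M a p ∧ ∀ c ∈ C, Complies a p c) : ∃ p, I.Plans M C a p := by
  obtain ⟨p, hp, hmin⟩ := (measure (Path.len (V := V))).wf.has_min
    {p | I.Serves M a p ∧ ∀ c ∈ C, Complies a p c} h
  exact ⟨p, hp, fun q hq hq' => not_lt.1 (hmin q ⟨hq, hq'⟩)⟩

theorem exists_plans_of_meetingCost_ne_top {M : Fin k → Meeting V} {a : Agent k}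
    (h : I.meetingCost a.task (M a.task).loc (M a.task).time ≠ ⊤) :
    ∃ p, I.Plans M ∅ a p := by
  obtain ⟨he, -, hg⟩ := of_meetingCost_ne_top h
  apply exists_plans
  rcases a with i | i
  · obtain ⟨p, hp⟩ := exists_serves_initiator he
    exact ⟨p, hp, by simp⟩
  · obtain ⟨p, hp, -⟩ := exists_serves_executor he hg
    exact ⟨p, hp, by simp⟩

/-- Without constraints, the paths planned for the two agents of a task cost no more than their
meeting. -/
theorem len_add_len_le_meetingCost {M : Fin k → Meeting V} {i : Fin k} {p q : Path V}
    (hp : I.Plans M ∅ (Sum.inl i) p) (hq : I.Plans M ∅ (Sum.inr i) q) :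
    ((p.len + q.len : ℕ) : ℕ∞) ≤ I.meetingCost i (M i).loc (M i).time := by
  by_cases h : I.meetingCost i (M i).loc (M i).time = ⊤
  · exact h ▸ le_top
  obtain ⟨he, -, hg⟩ := of_meetingCost_ne_top h
  obtain ⟨r, hr, hrlen⟩ := exists_serves_executor he hg
  have hplen : p.len = (M i).time := hp.1.1.2.2.2.1
  have hqlen : q.len ≤ r.len := hq.2 r hr (by simp)
  rw [meetingCost, if_pos he, two_mul, add_assoc, ← hrlen, ← hplen]
  exact_mod_cast Nat.add_le_add_left hqlen _

theorem serves_congr {M M' : Fin k → Meeting V} {a : Agent k} (h : M a.task = M' a.task)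
    (p : Path V) : I.Serves M a p ↔ I.Serves M' a p := by
  rcases a with i | i <;> simp only [Agent.task] at h <;> simp only [Serves, h]

theorem Plans.congr {M M' : Fin k → Meeting V} {C C' : Set (Constraint V k)} {a : Agent k}
    {p : Path V} (hM : M a.task = M' a.task)
    (hC : ∀ q, (∀ c ∈ C, Complies a q c) ↔ ∀ c ∈ C', Complies a q c) (h : I.Plans M C a p) :
    I.Plans M' C' a p := by
  simpa only [Plans, serves_congr hM, hC] using h

end Instance

/-! ### Constraints -/

/-- The agent on which a constraint is put. -/
def Constraint.agent {V : Type*} {k : ℕ} : Constraint V k → Agent k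
  | Constraint.vertex a _ _ => a
  | Constraint.edge a _ _ _ => a

/-- The time step of a constraint; for a forbidden move, the one in which it begins. -/
def Constraint.time {V : Type*} {k : ℕ} : Constraint V k → ℕ
  | Constraint.vertex _ _ t => t
  | Constraint.edge _ _ _ t => t

variable {V : Type*} {k : ℕ}

theorem complies_of_agent_ne {a : Agent k} {c : Constraint V k} (h : c.agent ≠ a) (p : Path V) :
    Complies a p c := by
  cases c <;> exact fun h' => absurd h' h

theorem finite_setOf_time_le [Finite V] (B : ℕ) : {c : Constraint V k | c.time ≤ B}.Finite := by
  refine ((Set.finite_range fun x : Agent k × V × Fin (B + 1) =>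
    Constraint.vertex x.1 x.2.1 x.2.2).union
    (Set.finite_range fun x : Agent k × V × V × Fin (B + 1) =>
      Constraint.edge x.1 x.2.1 x.2.2.1 x.2.2.2)).subset ?_
  rintro (⟨a, v, t⟩ | ⟨a, u, v, t⟩) ht
  · exact Or.inl ⟨(a, v, ⟨t, Nat.lt_succ_of_le ht⟩), rfl⟩
  · exact Or.inr ⟨(a, u, v, ⟨t, Nat.lt_succ_of_le ht⟩), rfl⟩

theorem len_le_sumOfCosts (P : Agent k → Path V) (a : Agent k) : (P a).len ≤ sumOfCosts P := by
  have h := Finset.single_le_sum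
    (f := fun i : Fin k => (P (Sum.inl i)).len + (P (Sum.inr i)).len)
    (fun _ _ => Nat.zero_le _) (Finset.mem_univ a.task)
  change _ ≤ sumOfCosts P at h
  rcases a with i | i <;> simp only [Agent.task] at h <;> omega

theorem exists_selects {s : Multiset (Node V k)} (hs : ∃ N, N ∈ s) :
    ∃ N rest, s = N ::ₘ rest ∧ Selects N rest := by
  -- Twice the cost, plus one for root nodes, encodes the lexicographic order of selection.
  let key : Node V k → ℕ := fun N => 2 * N.cost + N.isRoot.toNat
  obtain ⟨N, hN, hmin⟩ := (measure key).wf.has_min {N | N ∈ s} hs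
  obtain ⟨rest, rfl⟩ := Multiset.exists_cons_of_mem hN
  have hle : ∀ N' ∈ rest, 2 * N.cost + N.isRoot.toNat ≤ 2 * N'.cost + N'.isRoot.toNat :=
    fun N' hN' => not_lt.1 (hmin N' (Multiset.mem_cons_of_mem hN'))
  refine ⟨N, rest, rfl, fun N' hN' => ?_, fun hr N' hN' hc => ?_⟩
  · have := hle N' hN'
    have := N'.isRoot.toNat_le
    omega
  · have := hle N' hN'
    cases h : N'.isRoot
    · simp [hr, h, hc] at this
    · rfl

namespace Instance

variable {I : Instance V k}

/-! ### Meetings tables -/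

/-- A meetings table of task `i` as it occurs in a run: it stores no meeting earlier than the
earliest one, and it stores a meeting wherever the agents can meet at all. -/
def TableSound (I : Instance V k) (i : Fin k) (T : V → ℕ∞) : Prop :=
  ∀ v, I.earliest i v ≤ T v ∧ (T v = ⊤ → I.earliest i v = ⊤)

theorem tableSound_earliest (i : Fin k) : I.TableSound i (I.earliest i) :=
  fun _ => ⟨le_rfl, id⟩

theorem TableSound.next {i : Fin k} {T T' : V → ℕ∞} {m : Meeting V} (hT : I.TableSound i T)
    (h : I.NextMeeting i T m T') : I.TableSound i T' := by
  classical
  obtain ⟨hm, -, rfl⟩ := h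
  intro v
  by_cases hv : v = m.loc
  · subst hv
    rw [Function.update_self]
    refine ⟨((hT _).1.trans hm.le).trans le_self_add, fun h => absurd h ?_⟩
    exact_mod_cast ENat.natCast_ne_top (m.time + 1)
  · rw [Function.update_of_ne hv]
    exact hT v

theorem WellFormed.exists_meetingCost_ne_top (hwf : I.WellFormed) {i : Fin k} {T : V → ℕ∞}
    (hT : I.TableSound i T) : ∃ v, I.meetingCost i v (T v) ≠ ⊤ := by
  obtain ⟨v, -, h₁, h₂, h₃⟩ := hwf.exists_meeting i
  have he : I.earliest i v ≠ ⊤ := by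
    have h₀ := (hwf.connected_start i).symm.edist_ne_top
    have h₁ := h₁.symm.edist_ne_top
    have h₃ := h₃.symm.edist_ne_top
    rw [earliest, ← lt_top_iff_ne_top, max_lt_iff, ENat.add_lt_top]
    exact ⟨⟨h₀.lt_top, h₁.lt_top⟩, h₃.lt_top⟩
  have hTv : T v ≠ ⊤ := fun h => he ((hT v).2 h)
  refine ⟨v, ?_⟩
  rw [meetingCost, if_pos (hT v).1, ← lt_top_iff_ne_top, ENat.add_lt_top]
  exact ⟨WithTop.mul_lt_top (ENat.natCast_lt_top 2) hTv.lt_top, h₂.edist_ne_top.lt_top⟩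

theorem WellFormed.exists_nextMeeting [Finite V] (hwf : I.WellFormed) {i : Fin k} {T : V → ℕ∞}
    (hT : I.TableSound i T) : ∃ m T', I.NextMeeting i T m T' := by
  classical
  obtain ⟨v₀, hv₀⟩ := hwf.exists_meetingCost_ne_top hT
  have : Nonempty V := ⟨v₀⟩
  obtain ⟨v, hv⟩ := Finite.exists_min fun v => I.meetingCost i v (T v)
  obtain ⟨t, ht⟩ := ENat.ne_top_iff_exists.1
    (of_meetingCost_ne_top (ne_top_of_le_ne_top hv₀ (hv v₀))).2.1
  refine ⟨⟨v, t⟩, _, ht.symm, fun w => ?_, rfl⟩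
  change I.meetingCost i v t ≤ _
  rw [ht]
  exact hv w

theorem NextMeeting.meetingCost_ne_top (hwf : I.WellFormed) {i : Fin k} {T T' : V → ℕ∞}
    {m : Meeting V} (hT : I.TableSound i T) (h : I.NextMeeting i T m T') :
    I.meetingCost i m.loc m.time ≠ ⊤ := by
  obtain ⟨v₀, hv₀⟩ := hwf.exists_meetingCost_ne_top hT
  exact ne_top_of_le_ne_top hv₀ (h.2.1 v₀)

/-- Meetings come out of a table in the order of their costs: a meeting `m'` that is not taken out
yet costs at least as much as the next meeting `m`, and remains in the table unless it is `m`. -/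
theorem NextMeeting.le_meetingCost {i : Fin k} {T T' : V → ℕ∞} {m m' : Meeting V}
    (hT : I.TableSound i T) (h : I.NextMeeting i T m T') (hm' : T m'.loc ≤ m'.time) :
    I.meetingCost i m.loc m.time ≤ I.meetingCost i m'.loc m'.time ∧
      (m = m' ∨ T' m'.loc ≤ m'.time) := by
  classical
  obtain ⟨hm, hmin, rfl⟩ := h
  refine ⟨(hmin _).trans (meetingCost_mono (hT _).1 hm'), ?_⟩
  by_cases hl : m'.loc = m.loc
  · rw [hl] at hm'
    rw [hl, Function.update_self]
    rw [hm] at hm'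
    have hle : m.time ≤ m'.time := by exact_mod_cast hm'
    rcases hle.lt_or_eq with hlt | heq
    · right
      exact_mod_cast hlt
    · left
      cases m
      cases m'
      simp_all
  · right
    rwa [Function.update_of_ne hl]

/-! ### Soundness of the open nodes -/

/-- What holds of every open node in a run. -/
structure Sound (I : Instance V k) (N : Node V k) : Prop where
  plans : ∀ a, I.Plans N.meetings N.constraints a (N.solution a)
  constraints_eq_empty : N.isRoot = true → N.constraints = ∅
  tableSound : ∀ i, I.TableSound i (N.tables i)

theorem FirstRoot.sound {R : Node V k} (h : I.FirstRoot R) : I.Sound R := by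
  obtain ⟨-, hC, hm, hp⟩ := h
  exact ⟨hC ▸ hp, fun _ => hC, fun i => (tableSound_earliest i).next (hm i)⟩

theorem NextRoot.sound {N R : Node V k} {i : Fin k} (hN : I.Sound N) (hr : N.isRoot = true)
    (h : I.NextRoot N i R) : I.Sound R := by
  obtain ⟨m, T, pA, pB, hm, rfl, hA, hB⟩ := h
  refine ⟨?_, fun _ => rfl, fun j => ?_⟩
  · have hplans := hN.plans
    rw [hN.constraints_eq_empty hr] at hplans
    rintro (j | j) <;> by_cases hj : j = i
    · subst hj
      simpa using hA
    · have h := (hplans (Sum.inl j)).congr (M' := Function.update N.meetings i m)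
        (by simp [Agent.task, hj]) (fun _ => Iff.rfl)
      simpa [hj] using h
    · subst hj
      simpa using hB
    · have h := (hplans (Sum.inr j)).congr (M' := Function.update N.meetings i m)
        (by simp [Agent.task, hj]) (fun _ => Iff.rfl)
      simpa [hj] using h
  · change I.TableSound j (Function.update N.tables i T j)
    by_cases hj : j = i
    · subst hj
      rw [Function.update_self]
      exact (hN.tableSound j).next hm
    · rw [Function.update_of_ne hj]
      exact hN.tableSound j

/-- The regular node that results from adding the constraint `c` on agent `a` to `N`, the agent
being replanned to the path `p`. -/
def child (N : Node V k) (a : Agent k) (c : Constraint V k) (p : Path V) : Node V k where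
  isRoot := false
  constraints := insert c N.constraints
  meetings := N.meetings
  tables := N.tables
  solution := Function.update N.solution a p

theorem child_iff {N : Node V k} {a : Agent k} {c : Constraint V k}
    {new : Multiset (Node V k)} : I.Child N a c new ↔
      (∃ p, I.Plans N.meetings (insert c N.constraints) a p ∧ new = {child N a c p}) ∨
      ((¬ ∃ p, I.Plans N.meetings (insert c N.constraints) a p) ∧ new = 0) :=
  Iff.rfl

theorem exists_child (N : Node V k) (a : Agent k) (c : Constraint V k) :
    ∃ new, I.Child N a c new := by
  by_cases h : ∃ p, I.Plans N.meetings (insert c N.constraints) a p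
  · obtain ⟨p, hp⟩ := h
    exact ⟨_, child_iff.2 (Or.inl ⟨p, hp, rfl⟩)⟩
  · exact ⟨0, child_iff.2 (Or.inr ⟨h, rfl⟩)⟩

theorem exists_splits {N : Node V k} (h : ¬ ConflictFree N.meetings N.solution) :
    ∃ new, I.Splits N new := by
  rw [ConflictFree, not_and_or] at h
  push Not at h
  rcases h with ⟨a, b, v, t, h⟩ | ⟨a, b, u, v, t, h⟩
  · obtain ⟨X, hX⟩ := I.exists_child N a (Constraint.vertex a v t)
    obtain ⟨Y, hY⟩ := I.exists_child N b (Constraint.vertex b v t)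
    exact ⟨_, Or.inl ⟨a, b, v, t, X, Y, h, hX, hY, rfl⟩⟩
  · obtain ⟨X, hX⟩ := I.exists_child N a (Constraint.edge a u v t)
    obtain ⟨Y, hY⟩ := I.exists_child N b (Constraint.edge b v u t)
    exact ⟨_, Or.inr ⟨a, b, u, v, t, X, Y, h, hX, hY, rfl⟩⟩

/-- A node resulting from a split has one more constraint, on the replanned agent, which the
solution of the split node violates. -/
theorem Splits.exists_eq_child {N N' : Node V k} {new : Multiset (Node V k)} (h : I.Splits N new)
    (hN' : N' ∈ new) : ∃ a c p, c.agent = a ∧ ¬ Complies a (N.solution a) c ∧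
      c.time ≤ (N.solution a).len ∧ I.Plans N.meetings (insert c N.constraints) a p ∧
      N' = child N a c p := by
  have key : ∀ {a c X}, c.agent = a → ¬ Complies a (N.solution a) c →
      c.time ≤ (N.solution a).len → I.Child N a c X → N' ∈ X → ∃ a c p, c.agent = a ∧
      ¬ Complies a (N.solution a) c ∧ c.time ≤ (N.solution a).len ∧
      I.Plans N.meetings (insert c N.constraints) a p ∧ N' = child N a c p := by
    intro a c X ha hc ht hX hm
    rcases child_iff.1 hX with ⟨p, hp, rfl⟩ | ⟨-, rfl⟩
    · exact ⟨a, c, p, ha, hc, ht, hp, Multiset.mem_singleton.1 hm⟩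
    · exact absurd hm (Multiset.notMem_zero _)
  rcases h with ⟨a, b, v, t, X, Y, ⟨-, ha, hb, -⟩, hX, hY, rfl⟩ |
    ⟨a, b, u, v, t, X, Y, ⟨-, -, ha, hb⟩, hX, hY, rfl⟩
  · rcases Multiset.mem_add.1 hN' with hm | hm
    · exact key (c := Constraint.vertex a v t) rfl (fun h => h rfl ha.1 ha.2) ha.1 hX hm
    · exact key (c := Constraint.vertex b v t) rfl (fun h => h rfl hb.1 hb.2) hb.1 hY hm
  · rcases Multiset.mem_add.1 hN' with hm | hm
    · exact key (c := Constraint.edge a u v t) rfl (fun h => h rfl ha.1 ha.2)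
        (Nat.le_of_succ_le ha.1) hX hm
    · exact key (c := Constraint.edge b v u t) rfl (fun h => h rfl hb.1 hb.2)
        (Nat.le_of_succ_le hb.1) hY hm

theorem Splits.sound {N N' : Node V k} {new : Multiset (Node V k)} (hN : I.Sound N)
    (h : I.Splits N new) (hN' : N' ∈ new) : I.Sound N' := by
  obtain ⟨a, c, p, hca, -, -, hp, rfl⟩ := h.exists_eq_child hN'
  refine ⟨fun b => ?_, fun h => absurd h Bool.false_ne_true, hN.tableSound⟩
  change I.Plans N.meetings (insert c N.constraints) b (Function.update N.solution a p b)
  by_cases hb : b = a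
  · subst hb
    rwa [Function.update_self]
  · rw [Function.update_of_ne hb]
    refine (hN.plans b).congr rfl fun q => ?_
    rw [Set.forall_mem_insert]
    exact (and_iff_right (complies_of_agent_ne (by rw [hca]; exact Ne.symm hb) q)).symm

theorem WellFormed.exists_nextRoot [Finite V] (hwf : I.WellFormed) {N : Node V k}
    (hN : I.Sound N) (i : Fin k) : ∃ R, I.NextRoot N i R := by
  obtain ⟨m, T, hm⟩ := hwf.exists_nextMeeting (hN.tableSound i)
  have hc := hm.meetingCost_ne_top hwf (hN.tableSound i)
  have hplan : ∀ a : Agent k, a.task = i → ∃ p, I.Plans (Function.update N.meetings i m) ∅ a p := by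
    rintro a rfl
    apply exists_plans_of_meetingCost_ne_top
    simpa using hc
  obtain ⟨pA, hA⟩ := hplan (Sum.inl i) rfl
  obtain ⟨pB, hB⟩ := hplan (Sum.inr i) rfl
  exact ⟨_, m, T, pA, pB, hm, rfl, hA, hB⟩

theorem WellFormed.exists_firstRoot [Finite V] (hwf : I.WellFormed) : ∃ R, I.FirstRoot R := by
  choose m T hm using fun i => hwf.exists_nextMeeting (tableSound_earliest (I := I) i)
  choose P hP using fun a : Agent k => exists_plans_of_meetingCost_ne_top (M := m) (a := a)
    ((hm a.task).meetingCost_ne_top hwf (tableSound_earliest _))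
  exact ⟨⟨true, ∅, m, T, P⟩, rfl, rfl, hm, hP⟩

/-! ### Open nodes from which a solution can be reached -/

/-- The node `N` leaves room for the solution `Q` with meetings `M`: either `N` has the meetings `M`
and `Q` complies with its constraints, or `N` is a root node whose descendants among the root nodes
include one with the meetings `M`, because for every task the meeting in `M` is the one of `N` or
still to come from the table. In the latter case the meetings of `N` are also required to cost no
more than those in `M`. -/
def Covers (I : Instance V k) (M : Fin k → Meeting V) (Q : Agent k → Path V) (N : Node V k) :
    Prop :=
  (N.meetings = M ∧ ∀ a, ∀ c ∈ N.constraints, Complies a (Q a) c) ∨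
  (N.isRoot = true ∧ ∀ i,
    I.meetingCost i (N.meetings i).loc (N.meetings i).time ≤
      I.meetingCost i (M i).loc (M i).time ∧
    (N.meetings i = M i ∨ N.tables i (M i).loc ≤ (M i).time))

variable {M : Fin k → Meeting V} {Q : Agent k → Path V}

theorem Covers.cost_le {N : Node V k} (hN : I.Sound N) (hQ : ∀ a, I.Serves M a (Q a))
    (h : I.Covers M Q N) : N.cost ≤ sumOfCosts Q := by
  unfold Node.cost sumOfCosts
  refine Finset.sum_le_sum fun i _ => ?_
  rcases h with ⟨rfl, hc⟩ | ⟨hr, hm⟩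
  · exact Nat.add_le_add ((hN.plans _).2 _ (hQ _) (hc _)) ((hN.plans _).2 _ (hQ _) (hc _))
  · have hplans := hN.plans
    rw [hN.constraints_eq_empty hr] at hplans
    have h := ((len_add_len_le_meetingCost (hplans (Sum.inl i)) (hplans (Sum.inr i))).trans
      (hm i).1).trans (meetingCost_le_of_serves hQ i)
    exact_mod_cast h

theorem FirstRoot.covers {R : Node V k} (hR : I.FirstRoot R) (hQ : ∀ a, I.Serves M a (Q a)) :
    I.Covers M Q R := by
  refine Or.inr ⟨hR.1, fun i => ?_⟩
  refine (hR.2.2.1 i).le_meetingCost (tableSound_earliest i) ?_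
  exact (of_meetingCost_ne_top (ne_top_of_le_ne_top (ENat.natCast_ne_top _)
    (meetingCost_le_of_serves hQ i))).1

/-- If `Q` complies with the constraints of `N`, then it complies with one of the two constraints
that result from a conflict of `N`, since it does not have this conflict itself. -/
theorem Splits.exists_covers {N : Node V k} {new : Multiset (Node V k)} (h : I.Splits N new)
    (hM : N.meetings = M) (hQ : ∀ a, I.Serves M a (Q a)) (hQ' : ConflictFree M Q)
    (hc : ∀ a, ∀ c ∈ N.constraints, Complies a (Q a) c) : ∃ N' ∈ new, I.Covers M Q N' := by
  subst hM
  have key : ∀ {a c X}, I.Child N a c X → c.agent = a → Complies a (Q a) c →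
      ∃ N' ∈ X, I.Covers N.meetings Q N' := by
    intro a c X hX hca hac
    have hall : ∀ b, ∀ c' ∈ insert c N.constraints, Complies b (Q b) c' := by
      intro b
      rw [Set.forall_mem_insert]
      refine ⟨?_, hc b⟩
      by_cases hb : a = b
      · exact hb ▸ hac
      · exact complies_of_agent_ne (hca ▸ hb) _
    rcases child_iff.1 hX with ⟨p, -, rfl⟩ | ⟨hno, -⟩
    · exact ⟨_, Multiset.mem_singleton_self _, Or.inl ⟨rfl, hall⟩⟩
    · exact absurd (exists_plans ⟨Q a, hQ a, hall a⟩) hno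
  rcases h with ⟨a, b, v, t, X, Y, ⟨hab, -, -, hnm⟩, hX, hY, rfl⟩ |
    ⟨a, b, u, v, t, X, Y, ⟨hab, huv, -, -⟩, hX, hY, rfl⟩
  · by_cases ha : Complies a (Q a) (Constraint.vertex a v t)
    · obtain ⟨N', h, h'⟩ := key hX rfl ha
      exact ⟨N', Multiset.mem_add.2 (Or.inl h), h'⟩
    · have hb : Complies b (Q b) (Constraint.vertex b v t) := by
        intro _ htb hpb
        refine ha fun _ hta hpa => hQ'.1 a b v t ⟨hab, ⟨hta, hpa⟩, ⟨htb, hpb⟩, hnm⟩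
      obtain ⟨N', h, h'⟩ := key hY rfl hb
      exact ⟨N', Multiset.mem_add.2 (Or.inr h), h'⟩
  · by_cases ha : Complies a (Q a) (Constraint.edge a u v t)
    · obtain ⟨N', h, h'⟩ := key hX rfl ha
      exact ⟨N', Multiset.mem_add.2 (Or.inl h), h'⟩
    · have hb : Complies b (Q b) (Constraint.edge b v u t) := by
        intro _ htb hpb
        refine ha fun _ hta hpa => hQ'.2 a b u v t ⟨hab, huv, ⟨hta, hpa⟩, ⟨htb, hpb⟩⟩
      obtain ⟨N', h, h'⟩ := key hY rfl hb
      exact ⟨N', Multiset.mem_add.2 (Or.inr h), h'⟩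

theorem NextRoot.covers {N R : Node V k} {i : Fin k} (hN : I.Sound N) (h : I.NextRoot N i R)
    (hi : N.meetings i ≠ M i)
    (hcov : ∀ i, I.meetingCost i (N.meetings i).loc (N.meetings i).time ≤
      I.meetingCost i (M i).loc (M i).time ∧
      (N.meetings i = M i ∨ N.tables i (M i).loc ≤ (M i).time)) : I.Covers M Q R := by
  obtain ⟨m, T, pA, pB, hm, rfl, -, -⟩ := h
  refine Or.inr ⟨rfl, fun j => ?_⟩
  by_cases hj : j = i
  · subst hj
    simpa using hm.le_meetingCost (hN.tableSound j) ((hcov j).2.resolve_left hi)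
  · simpa [hj] using hcov j

/-- Either the node has the meetings of the covered solution, and a node resulting from the split
covers it, or the meeting of some task has to be replaced, and the next root node for this task
covers it. -/
theorem exists_covers_of_root {N : Node V k} {new : Multiset (Node V k)} {R : Fin k → Node V k}
    (hN : I.Sound N) (hr : N.isRoot = true) (hR : ∀ i, I.NextRoot N i (R i))
    (hnew : I.Splits N new) (hQ : ∀ a, I.Serves M a (Q a)) (hQ' : ConflictFree M Q)
    (h : I.Covers M Q N) : (∃ N' ∈ new, I.Covers M Q N') ∨ ∃ i, I.Covers M Q (R i) := by
  by_cases hM : N.meetings = M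
  · refine Or.inl (hnew.exists_covers hM hQ hQ' ?_)
    simp [hN.constraints_eq_empty hr]
  · rcases h with ⟨h, -⟩ | ⟨-, h⟩
    · exact absurd h hM
    · obtain ⟨i, hi⟩ := Function.ne_iff.1 hM
      exact Or.inr ⟨i, (hR i).covers hN hi h⟩

/-! ### An invariant of the main loop -/

/-- While Co-CBS is running, all open nodes are sound, and every feasible solution is covered by an
open node; a returned solution is optimal. -/
def Invariant (I : Instance V k) : Config V k → Prop
  | Config.running s => (∀ N ∈ s, I.Sound N) ∧
      ∀ M Q, (∀ a, I.Serves M a (Q a)) → ConflictFree M Q → ∃ N ∈ s, I.Covers M Q N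
  | Config.returned P => I.Optimal P

theorem Initial.invariant {c : Config V k} (h : I.Initial c) : I.Invariant c := by
  obtain ⟨R, hR, rfl⟩ := h
  refine ⟨fun N hN => ?_, fun M Q hQ _ => ⟨R, Multiset.mem_singleton_self R, hR.covers hQ⟩⟩
  rw [Multiset.mem_singleton.1 hN]
  exact hR.sound

/-- A selected node costs no more than any feasible solution. -/
theorem Invariant.cost_le {N : Node V k} {rest : Multiset (Node V k)}
    (h : I.Invariant (Config.running (N ::ₘ rest))) (hN : Selects N rest)
    (hQ : I.Feasible Q) : N.cost ≤ sumOfCosts Q := by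
  obtain ⟨M, hQ, hQ'⟩ := hQ
  obtain ⟨N', hN', hcov⟩ := h.2 M Q hQ hQ'
  refine le_trans ?_ (hcov.cost_le (h.1 N' hN') hQ)
  rcases Multiset.mem_cons.1 hN' with rfl | hN'
  · exact le_rfl
  · exact hN.1 N' hN'

theorem Step.invariant {c c' : Config V k} (h : I.Step c c') (hc : I.Invariant c) :
    I.Invariant c' := by
  cases h with
  | ret N rest hN hcf =>
    have hs := hc.1 N (Multiset.mem_cons_self _ _)
    exact ⟨⟨N.meetings, fun a => (hs.plans a).1.1, hcf⟩, fun Q hQ => hc.cost_le hN hQ⟩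
  | regular N rest new hN hr hnew =>
    have hs := hc.1 N (Multiset.mem_cons_self _ _)
    refine ⟨fun N' hN' => ?_, fun M Q hQ hQ' => ?_⟩
    · rcases Multiset.mem_add.1 hN' with h | h
      · exact hnew.sound hs h
      · exact hc.1 N' (Multiset.mem_cons_of_mem h)
    · obtain ⟨N', hN', hcov⟩ := hc.2 M Q hQ hQ'
      rcases Multiset.mem_cons.1 hN' with rfl | hN'
      · rcases hcov with ⟨hM, hcon⟩ | ⟨hr', -⟩
        · obtain ⟨N'', h, h'⟩ := hnew.exists_covers hM hQ hQ' hcon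
          exact ⟨N'', Multiset.mem_add.2 (Or.inl h), h'⟩
        · simp [hr] at hr'
      · exact ⟨N', Multiset.mem_add.2 (Or.inr hN'), hcov⟩
  | root N rest new R hN hr hR hnew =>
    have hs := hc.1 N (Multiset.mem_cons_self _ _)
    refine ⟨fun N' hN' => ?_, fun M Q hQ hQ' => ?_⟩
    · rcases Multiset.mem_add.1 hN' with h | h
      · rcases Multiset.mem_add.1 h with h | h
        · exact hnew.sound hs h
        · obtain ⟨i, -, rfl⟩ := Multiset.mem_map.1 h
          exact (hR i).sound hs hr
      · exact hc.1 N' (Multiset.mem_cons_of_mem h)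
    · obtain ⟨N', hN', hcov⟩ := hc.2 M Q hQ hQ'
      rcases Multiset.mem_cons.1 hN' with rfl | hN'
      · rcases exists_covers_of_root hs hr hR hnew hQ hQ' hcov with ⟨N'', h, h'⟩ | ⟨i, h'⟩
        · exact ⟨N'', Multiset.mem_add.2 (Or.inl (Multiset.mem_add.2 (Or.inl h))), h'⟩
        · exact ⟨R i, Multiset.mem_add.2 (Or.inl (Multiset.mem_add.2 (Or.inr
            (Multiset.mem_map_of_mem R (Finset.mem_univ i))))), h'⟩
      · exact ⟨N', Multiset.mem_add.2 (Or.inr hN'), hcov⟩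

theorem WellFormed.exists_step [Finite V] (hwf : I.WellFormed) (hQ : I.Feasible Q)
    {s : Multiset (Node V k)} (hs : I.Invariant (Config.running s)) :
    ∃ c, I.Step (Config.running s) c := by
  obtain ⟨M, hQ, hQ'⟩ := hQ
  obtain ⟨N₀, hN₀, -⟩ := hs.2 M Q hQ hQ'
  obtain ⟨N, rest, rfl, hN⟩ := exists_selects ⟨N₀, hN₀⟩
  by_cases hcf : ConflictFree N.meetings N.solution
  · exact ⟨_, Step.ret N rest hN hcf⟩
  obtain ⟨new, hnew⟩ := I.exists_splits hcf
  cases hr : N.isRoot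
  · exact ⟨_, Step.regular N rest new hN hr hnew⟩
  · choose R hR using hwf.exists_nextRoot (hs.1 N (Multiset.mem_cons_self _ _))
    exact ⟨_, Step.root N rest new R hN hr hR hnew⟩

/-! ### Termination -/

/-- A measure that decreases from every expanded node of cost at most `B` to its successors. It
counts the constraints with a time step up to `B` that the node does not have yet and, for a root
node of cost at most `B`, how far the entries of the meetings tables can still advance up to
`B + 1`. Root nodes of higher cost need no such term, since they are never expanded when `B` is the
cost of a feasible solution. Entries `⊤` never change, so that their conversion to `0` is
harmless. -/
noncomputable def rank [Fintype V] (B : ℕ) (N : Node V k) : ℕ :=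
  ({c : Constraint V k | c.time ≤ B} \ N.constraints).ncard +
    if N.isRoot = true ∧ N.cost ≤ B then
      (∑ x : Fin k × V, (B + 1 - (N.tables x.1 x.2).toNat)) + 1
    else 0

theorem Splits.rank_lt [Fintype V] {N N' : Node V k} {new : Multiset (Node V k)} {B : ℕ}
    (hN : I.Sound N) (hB : N.cost ≤ B) (h : I.Splits N new) (hN' : N' ∈ new) :
    rank B N' < rank B N := by
  obtain ⟨a, c, p, -, hc, hct, -, rfl⟩ := h.exists_eq_child hN'
  have hlt : ({c : Constraint V k | c.time ≤ B} \ (insert c N.constraints)).ncard <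
      ({c : Constraint V k | c.time ≤ B} \ N.constraints).ncard := by
    refine Set.ncard_lt_ncard ?_ ((finite_setOf_time_le B).sdiff)
    refine (Set.ssubset_iff_of_subset
      (Set.sdiff_subset_sdiff_right (Set.subset_insert _ _))).2 ⟨c, ⟨?_, ?_⟩, ?_⟩
    · exact (hct.trans (len_le_sumOfCosts N.solution a)).trans hB
    · exact fun hmem => hc ((hN.plans a).1.2 c hmem)
    · exact fun hmem => hmem.2 (Set.mem_insert _ _)
  rw [rank, rank, if_neg (fun h => Bool.false_ne_true h.1)]
  exact lt_of_lt_of_le hlt (Nat.le_add_right _ _)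

theorem NextRoot.rank_lt [Fintype V] {N R : Node V k} {i : Fin k} {B : ℕ} (hN : I.Sound N)
    (hB : N.cost ≤ B) (hr : N.isRoot = true) (h : I.NextRoot N i R) :
    rank B R < rank B N := by
  have hRC := (h.sound hN hr).plans (Sum.inl i)
  obtain ⟨m, T, pA, pB, ⟨hm, -, rfl⟩, rfl, -, -⟩ := h
  rw [rank, rank, hN.constraints_eq_empty hr,
    if_pos (show N.isRoot = true ∧ N.cost ≤ B from ⟨hr, hB⟩)]
  refine Nat.add_lt_add_left ?_ _
  split_ifs with hR
  · have hmB : m.time ≤ B := by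
      have h₁ := (len_le_sumOfCosts _ (Sum.inl i)).trans hR.2
      rw [hRC.1.1.2.2.2.1] at h₁
      simpa using h₁
    refine Nat.succ_lt_succ (Finset.sum_lt_sum ?_ ⟨(i, m.loc), Finset.mem_univ _, ?_⟩)
    · rintro ⟨j, v⟩ -
      by_cases hj : j = i
      · subst hj
        by_cases hv : v = m.loc
        · subst hv
          simp only [Function.update_self, hm]
          have : ((m.time : ℕ∞) + 1).toNat = m.time + 1 := ENat.toNat_natCast (m.time + 1)
          rw [this, ENat.toNat_natCast]
          omega
        · simp [hv]
      · simp [hj]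
    · simp only [Function.update_self, hm]
      have : ((m.time : ℕ∞) + 1).toNat = m.time + 1 := ENat.toNat_natCast (m.time + 1)
      rw [this, ENat.toNat_natCast]
      omega
  · exact Nat.succ_pos _

/-- As long as there is a feasible solution of cost `B`, an iteration that does not return replaces
one open node by finitely many nodes of lower rank. -/
theorem Step.cutExpand [Fintype V] {s s' : Multiset (Node V k)} (hQ : I.Feasible Q)
    (hs : I.Invariant (Config.running s)) (h : I.Step (Config.running s) (Config.running s')) :
    Relation.CutExpand (fun N' N => rank (sumOfCosts Q) N' < rank (sumOfCosts Q) N) s' s := by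
  cases h with
  | regular N rest new hN hr hnew =>
    refine ⟨new, N, fun N' hN' => hnew.rank_lt (hs.1 N (Multiset.mem_cons_self _ _))
      (hs.cost_le hN hQ) hN', ?_⟩
    rw [← Multiset.singleton_add]
    abel
  | root N rest new R hN hr hR hnew =>
    have hsN := hs.1 N (Multiset.mem_cons_self _ _)
    refine ⟨new + Finset.univ.val.map R, N, fun N' hN' => ?_, ?_⟩
    · rcases Multiset.mem_add.1 hN' with h | h
      · exact hnew.rank_lt hsN (hs.cost_le hN hQ) h
      · obtain ⟨i, -, rfl⟩ := Multiset.mem_map.1 h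
        exact (hR i).rank_lt hsN (hs.cost_le hN hQ) hr
    · rw [← Multiset.singleton_add]
      abel

theorem not_exists_infinite_run [Finite V] (hQ : I.Feasible Q) :
    ¬ ∃ run : ℕ → Config V k, I.Initial (run 0) ∧ ∀ n, I.Step (run n) (run (n + 1)) := by
  have := Fintype.ofFinite V
  rintro ⟨run, h0, hstep⟩
  have hinv : ∀ n, I.Invariant (run n) := by
    intro n
    induction n with
    | zero => exact h0.invariant
    | succ n ih => exact (hstep n).invariant ih
  have hrun : ∀ n, ∃ s, run n = Config.running s := by
    intro n
    have := hstep n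
    cases hn : run n with
    | running s => exact ⟨s, rfl⟩
    | returned P =>
      rw [hn] at this
      cases this
  choose s hs using hrun
  have hwf : WellFounded (Relation.CutExpand
      (fun N' N : Node V k => rank (sumOfCosts Q) N' < rank (sumOfCosts Q) N)) :=
    WellFounded.cutExpand (measure _).wf
  refine (wellFounded_iff_isEmpty_descending_chain.1 hwf).false ⟨s, fun n => ?_⟩
  have h := hstep n
  have h' := hinv n
  rw [hs n, hs (n + 1)] at h
  rw [hs n] at h'
  exact h.cutExpand hQ h'

end Instance

end CoMAPF

/-- On every well-formed Co-MAPF instance, Co-CBS returns an optimal solution. Well-formedness is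
understood to include that agents resting at their start locations do not block other tasks; any
well-formed instance that has a feasible solution at all is covered as well. -/
theorem theorem2 {V : Type*} [Finite V] {k : ℕ} (I : CoMAPF.Instance V k)
    (hwf : I.WellFormed) (hfree : I.StartsFree ∨ ∃ Q, I.Feasible Q) :
    I.CoCBSReturns I.Optimal := by
  obtain ⟨Q, hQ⟩ : ∃ Q, I.Feasible Q := hfree.elim hwf.exists_feasible id
  refine ⟨?_, CoMAPF.Instance.not_exists_infinite_run hQ, fun c c' hc hreach hstuck => ?_⟩
  · obtain ⟨R, hR⟩ := hwf.exists_firstRoot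
    exact ⟨_, R, hR, rfl⟩
  · have hinv : I.Invariant c' := by
      clear hstuck
      induction hreach with
      | refl => exact hc.invariant
      | tail _ h ih =>
        exact h.invariant ih
    cases c' with
    | running s =>
      obtain ⟨d, hd⟩ := hwf.exists_step hQ hinv
      exact absurd hd (hstuck d)
    | returned P => exact ⟨P, rfl, hinv⟩
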